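/- Let $k$ be an algebraically closed field of characteristic $0$, and let $X \subset \mathbb{A}^n_k$ be an irreducible affine variety that is not a single point. Let $k[X]$ be the algebra of polynomial functions on $X$, i.e. $k[x_1,\dots,x_n]$ modulo the ideal of polynomials vanishing on $X$. Then the Lie algebra $\mathrm{Der}_k(k[X])$ of polynomial vector fields on $X$, with the commutator bracket, is a simple Lie algebra over $k$ (that is, it is non-abelian and has no Lie ideals other than $0$ and itself) if and only if $X$ is smooth (that is, at every point $P \in X$ the Zariski tangent space of $X$ at $P$ has dimension $\dim X$). -/

import Mathlib

open MvPolynomial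

noncomputable section

namespace AffineVariety

universe u

variable {k : Type u} [Field k] {n : ℕ}

/-- Zariski closed subsets of affine `n`-space over `k`: zero sets of families of polynomials. -/
def IsAlgebraicSet (X : Set (Fin n → k)) : Prop :=
  ∃ S : Set (MvPolynomial (Fin n) k), X = {x | ∀ f ∈ S, eval x f = 0}

/-- An irreducible affine variety in affine `n`-space: a nonempty Zariski closed set which is
not contained in the union of two Zariski closed sets unless it is contained in one of them. -/
structure IsIrreducibleVariety (X : Set (Fin n → k)) : Prop where
  isAlgebraicSet : IsAlgebraicSet X
  nonempty : X.Nonempty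
  irreducible : ∀ Y Z : Set (Fin n → k), IsAlgebraicSet Y → IsAlgebraicSet Z →
    X ⊆ Y ∪ Z → X ⊆ Y ∨ X ⊆ Z

/-- The algebra `k[X]` of polynomial functions on `X`: all polynomials modulo those that
vanish on `X`. -/
abbrev CoordinateRing (X : Set (Fin n → k)) : Type u :=
  MvPolynomial (Fin n) k ⧸ vanishingIdeal k X

/-- The Lie algebra of polynomial vector fields on `X`, with the commutator bracket. -/
abbrev VectorFields (X : Set (Fin n → k)) : Type u :=
  Derivation k (CoordinateRing X) (CoordinateRing X)

/-- The Zariski tangent space of `X` at `P`: the vectors `v` killed by the differential at `P`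
of every polynomial that vanishes on `X`. -/
def tangentSpace (X : Set (Fin n → k)) (P : Fin n → k) : Submodule k (Fin n → k) where
  carrier := {v | ∀ f ∈ vanishingIdeal k X, ∑ j, eval P (pderiv j f) * v j = 0}
  zero_mem' := fun f _ => by simp
  add_mem' := fun {v w} hv hw f hf => by
    simp [mul_add, Finset.sum_add_distrib, hv f hf, hw f hf]
  smul_mem' := fun c v hv f hf => by
    simp only [Pi.smul_apply, smul_eq_mul, mul_left_comm _ c, ← Finset.mul_sum, hv f hf, mul_zero]

/-- The dimension of an irreducible variety `X`: the transcendence degree over `k` of the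
field `k(X)` of rational functions. -/
def dim (X : Set (Fin n → k)) : Cardinal.{u} :=
  Algebra.trdeg k (FractionRing (CoordinateRing X))

/-- `P` is a nonsingular point of the irreducible variety `X`: the tangent space at `P` has
the dimension of `X`. -/
def IsNonsingularAt (X : Set (Fin n → k)) (P : Fin n → k) : Prop :=
  Module.rank k (tangentSpace X P) = dim X

/-- An irreducible variety is smooth if all its points are nonsingular. -/
def IsSmoothVariety (X : Set (Fin n → k)) : Prop :=
  ∀ P ∈ X, IsNonsingularAt X P

end AffineVariety

end

/-! Let A = k[X] and let Ω be its module of differentials. Both simplicity and smoothness are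
compared with the ideals of A stable under all derivations. If Der A is simple, a stable ideal I is
trivial, because I • Der A is a Lie ideal (`stableIdealsTrivial_of_isSimple`). This is applied to
the splitting ideal, formed by the scalars whose action on Ω is a sum of rank one endomorphisms. It
is stable because Lie derivatives act compatibly on Ω and its dual
(`isStable_splittingIdeal_kaehlerDifferential`), and nonzero because Ω is generically free. So it is
A, that is, Ω is finite projective; equivalently, every fiber of Ω at a point has dimension dim X.
These fibers are dual to the tangent spaces, so X is smooth. Conversely, if Ω is finite projective,
each point, with maximal ideal m, has an Euler field E ∈ m • Der A acting as the identity on m / m ^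
2. It forces a stable ideal inside m into every power of m, hence to be 0
(`eq_bot_of_isStable_of_le_ker`). Without nontrivial stable ideals Der A is simple: a nonzero Lie
ideal contains some A • e with e ≠ 0, and then f • Der A for all f in a nonzero stable ideal. -/

open TensorProduct KaehlerDifferential

/-! ### Stable ideals and Lie ideals of derivations -/

namespace Derivation

variable {k A : Type*} [CommRing k] [CommRing A] [Algebra k A]

instance [NoZeroDivisors A] : Module.IsTorsionFree A (Derivation k A A) :=
  coe_injective.moduleIsTorsionFree _ fun _ _ => rfl

variable (k) in
/-- An ideal mapped into itself by every `k`-derivation of the algebra. -/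
def IsStable (I : Ideal A) : Prop :=
  ∀ d : Derivation k A A, ∀ a ∈ I, d a ∈ I

lemma lie_smul_right (d e : Derivation k A A) (f : A) :
    ⁅d, f • e⁆ = d f • e + f • ⁅d, e⁆ := by
  ext a
  simp only [commutator_apply, add_apply, smul_apply, smul_eq_mul, leibniz]
  ring

lemma exists_apply_apply_ne_zero [IsDomain A] (h2 : (2 : A) ≠ 0) {d : Derivation k A A}
    (hd : d ≠ 0) : ∃ f, d (d f) ≠ 0 := by
  by_contra! h
  refine hd (ext fun f => ?_)
  -- If `d ∘ d = 0`, then `d (d (f * f))` reduces to `2 * (d f * d f)`.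
  have := h (f * f)
  simp only [leibniz, smul_eq_mul, map_add, h f, mul_zero, zero_add] at this
  have h' : 2 * (d f * d f) = 0 := by linear_combination this
  simpa [h2] using h'

lemma exists_smul_mem_of_lieIdeal [IsDomain A] (h2 : (2 : A) ≠ 0)
    (L : LieIdeal k (Derivation k A A)) (hL : L ≠ ⊥) :
    ∃ e : Derivation k A A, e ≠ 0 ∧ ∀ a : A, a • e ∈ L := by
  obtain ⟨d, hdL, hd⟩ : ∃ d ∈ L, d ≠ 0 := by
    by_contra! h
    exact hL ((LieSubmodule.eq_bot_iff _).2 h)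
  obtain ⟨f, hf⟩ := exists_apply_apply_ne_zero h2 hd
  have hlie : ∀ x y : Derivation k A A, x ∈ L → ⁅x, y⁆ ∈ L := fun x y hx => lie_mem_left k _ L x y hx
  have hmem : d f • d ∈ L := by
    have := hlie d (f • d) hdL
    rwa [lie_smul_right, lie_self, smul_zero, add_zero] at this
  -- The witness comes from `⁅d, (a * d f) • d⁆ - ⁅d f • d, a • d⁆ = (2 * a * d (d f)) • d`: the
  -- terms in `d a` cancel.
  refine ⟨(2 * d (d f)) • d, smul_ne_zero (mul_ne_zero h2 hf) hd, fun a => ?_⟩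
  have := sub_mem (hlie d ((a * d f) • d) hdL) (hlie (d f • d) (a • d) hmem)
  convert this using 1
  ext b
  simp only [commutator_apply, sub_apply, smul_apply, smul_eq_mul, leibniz]
  ring

variable (k A) in
/-- The algebra has no stable ideals but the two trivial ones. -/
def StableIdealsTrivial : Prop :=
  ∀ I : Ideal A, IsStable k I → I = ⊥ ∨ I = ⊤

theorem isSimple_of_stableIdealsTrivial [IsDomain A] (h2 : (2 : A) ≠ 0)
    [Nontrivial (Derivation k A A)] (h : StableIdealsTrivial k A) :
    LieAlgebra.IsSimple k (Derivation k A A) where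
  eq_bot_or_eq_top L := by
    refine or_iff_not_imp_left.2 fun hL => ?_
    obtain ⟨e, he, heL⟩ := exists_smul_mem_of_lieIdeal h2 L hL
    let J : Ideal A :=
      { carrier := {f | ∀ d : Derivation k A A, f • d ∈ L}
        add_mem' := fun {f g} hf hg d => by simpa [add_smul] using add_mem (hf d) (hg d)
        zero_mem' := fun d => by simp
        smul_mem' := fun c f hf d => by
          simpa [smul_smul, mul_comm] using hf (c • d) }
    have hJ : IsStable k J := fun d f hf e => by
      have := sub_mem (LieSubmodule.lie_mem L (x := d) (hf e)) (hf ⁅d, e⁆)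
      rwa [lie_smul_right, add_sub_cancel_right] at this
    have hne : J ≠ ⊥ := by
      obtain ⟨f, hf⟩ : ∃ f, e f ≠ 0 := by
        by_contra! h
        exact he (ext h)
      -- Here `e f • d = ⁅e, f • d⁆ + (⁅d, f • e⁆ - d f • e)`, and all terms on the right lie in
      -- `L`.
      refine (Submodule.ne_bot_iff _).2 ⟨e f, fun d => ?_, hf⟩
      have h1 := lie_mem_left k _ L e (f • d) (by simpa using heL 1)
      have h3 := sub_mem (LieSubmodule.lie_mem L (x := d) (heL f)) (heL (d f))
      rw [lie_smul_right] at h1 h3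
      have := add_mem h1 h3
      rwa [add_sub_cancel_left, ← lie_skew, smul_neg, neg_add_cancel_right] at this
    have h1 : (1 : A) ∈ J := ((h J hJ).resolve_left hne) ▸ Submodule.mem_top
    exact eq_top_iff.2 fun d _ => by simpa using h1 d
  non_abelian hab := by
    obtain ⟨d, hd⟩ := exists_ne (0 : Derivation k A A)
    obtain ⟨f, hf⟩ : ∃ f, d f ≠ 0 := by
      by_contra! h
      exact hd (ext h)
    have := hab.trivial d (f • d)
    rw [lie_smul_right, lie_self, smul_zero, add_zero] at this
    exact smul_ne_zero hf hd this

/-- By the Leibniz rule I • Der A is a Lie ideal. If it is 0, torsion-freeness gives I = 0. If it is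
everything, Nakayama's lemma gives r ≡ 1 mod I killing Der A, so r = 0 and 1 ∈ I. -/
theorem stableIdealsTrivial_of_isSimple [IsDomain A] [Module.Finite A (Derivation k A A)]
    (h : LieAlgebra.IsSimple k (Derivation k A A)) : StableIdealsTrivial k A := by
  intro I hI
  let L : LieIdeal k (Derivation k A A) :=
    { (I • (⊤ : Submodule A (Derivation k A A))).restrictScalars k with
      lie_mem := fun {d e} he => by
        change ⁅d, e⁆ ∈ I • (⊤ : Submodule A (Derivation k A A))
        change e ∈ I • (⊤ : Submodule A (Derivation k A A)) at he
        induction he using Submodule.smul_induction_on' with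
        | smul f hf e he =>
          rw [lie_smul_right]
          exact add_mem (Submodule.smul_mem_smul (hI d f hf) trivial)
            (Submodule.smul_mem_smul hf trivial)
        | add x _ y _ hx hy => rw [lie_add]; exact add_mem hx hy }
  have hL : ∀ e, e ∈ L ↔ e ∈ I • (⊤ : Submodule A (Derivation k A A)) := fun e => Iff.rfl
  obtain ⟨d, hd⟩ : ∃ d : Derivation k A A, d ≠ 0 := by
    by_contra! h0
    exact h.non_abelian ⟨fun x y => h0 _⟩
  rcases h.eq_bot_or_eq_top L with hbot | htop
  · left
    refine (Submodule.eq_bot_iff _).2 fun f hf => ?_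
    have := (hL (f • d)).2 (Submodule.smul_mem_smul hf trivial)
    rw [hbot, LieSubmodule.mem_bot] at this
    exact (smul_eq_zero.1 this).resolve_right hd
  · right
    have hle : (⊤ : Submodule A (Derivation k A A)) ≤ I • ⊤ := fun e _ =>
      (hL e).1 (htop ▸ LieSubmodule.mem_top e)
    obtain ⟨r, hr, hr0⟩ :=
      Submodule.exists_sub_one_mem_and_smul_eq_zero_of_fg_of_le_smul I ⊤ Module.Finite.fg_top hle
    have : r = 0 := (smul_eq_zero.1 (hr0 d trivial)).resolve_right hd
    rw [this, zero_sub] at hr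
    exact (Ideal.eq_top_iff_one _).2 (by simpa using neg_mem hr)

end Derivation

/-! ### The splitting ideal of a module -/

section SplittingIdeal

variable {R M : Type*} [CommRing R] [AddCommGroup M] [Module R M]

variable (R M) in
/-- The ideal of the scalars `c` such that multiplication by `c` on `M` is a sum of endomorphisms
of rank one; equivalently, it factors through a finite free module. -/
def Module.splittingIdeal : Ideal R :=
  (LinearMap.range (dualTensorHom R M M)).comap (LinearMap.toSpanSingleton R (Module.End R M) 1)

lemma Module.mem_splittingIdeal {c : R} :
    c ∈ splittingIdeal R M ↔ ∃ t, ∀ x, dualTensorHom R M M t x = c • x := by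
  simp [splittingIdeal, LinearMap.ext_iff]

lemma Module.one_mem_range_dualTensorHom_iff :
    1 ∈ LinearMap.range (dualTensorHom R M M) ↔ splittingIdeal R M = ⊤ := by
  simp [splittingIdeal, Ideal.eq_top_iff_one]

end SplittingIdeal

/-! ### Lie derivatives and stability of the splitting ideal -/

namespace Derivation

variable {k A : Type*} [CommRing k] [CommRing A] [Algebra k A]

/-- Pairs of elements of `M`, on which `a : A` acts as the matrix with diagonal entries `a` and
lower left entry `d a`: the base change of `M` along `a ↦ a + ε d a`. -/
@[nolint unusedArguments]
def Twist (_ : Derivation k A A) (M : Type*) : Type _ := M × M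

namespace Twist

variable (d : Derivation k A A) {M : Type*} [AddCommGroup M] [Module A M] [Module k M]

instance : AddCommGroup (Twist d M) := inferInstanceAs (AddCommGroup (M × M))

instance : Module k (Twist d M) := inferInstanceAs (Module k (M × M))

/-- The Lie derivative is not A-linear, but its graph ω ↦ (ω, L_d ω) is linear for this action, so
the universal property of Ω can produce it. -/
instance : Module A (Twist d M) where
  smul a x := (a • x.1, a • x.2 + d a • x.1)
  one_smul x := Prod.ext (one_smul A x.1) (by
    change (1 : A) • x.2 + d 1 • x.1 = x.2
    simp)
  mul_smul a b x := Prod.ext (mul_smul a b x.1) (by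
    change (a * b) • x.2 + d (a * b) • x.1 = a • (b • x.2 + d b • x.1) + d a • b • x.1
    simp only [leibniz, smul_eq_mul]
    module)
  smul_zero a := Prod.ext (smul_zero a) (by
    change a • (0 : M) + d a • (0 : M) = 0
    simp)
  smul_add a x y := Prod.ext (smul_add a x.1 y.1) (by
    change a • (x.2 + y.2) + d a • (x.1 + y.1) = (a • x.2 + d a • x.1) + (a • y.2 + d a • y.1)
    module)
  add_smul a b x := Prod.ext (add_smul a b x.1) (by
    change (a + b) • x.2 + d (a + b) • x.1 = (a • x.2 + d a • x.1) + (b • x.2 + d b • x.1)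
    rw [map_add]
    module)
  zero_smul x := Prod.ext (zero_smul A x.1) (by
    change (0 : A) • x.2 + d 0 • x.1 = 0
    simp)

variable (M) in
/-- The first component. -/
def fst : Twist d M →+ M := AddMonoidHom.fst M M

variable (M) in
/-- The second component. -/
def snd : Twist d M →+ M := AddMonoidHom.snd M M

omit [Module k M] in
lemma fst_smul (a : A) (x : Twist d M) : fst d M (a • x) = a • fst d M x := rfl

omit [Module k M] in
lemma snd_smul (a : A) (x : Twist d M) :
    snd d M (a • x) = a • snd d M x + d a • fst d M x := rfl

instance [IsScalarTower k A M] : IsScalarTower k A (Twist d M) where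
  smul_assoc c a x := Prod.ext (smul_assoc c a x.1) (by
    change (c • a) • x.2 + d (c • a) • x.1 = c • (a • x.2 + d a • x.1)
    simp)

end Twist

/-- The derivation `f ↦ (Df, D(d f))` into the twisted pairs of differentials. -/
noncomputable def twistedD (d : Derivation k A A) : Derivation k A (Twist d Ω[A⁄k]) where
  toFun f := ((D k A f, D k A (d f)) : Ω[A⁄k] × Ω[A⁄k])
  map_add' f g := Prod.ext (map_add _ f g) (by
    change D k A (d (f + g)) = D k A (d f) + D k A (d g)
    simp)
  map_smul' c f := Prod.ext (map_smul _ c f) (by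
    change D k A (d (c • f)) = c • D k A (d f)
    simp)
  map_one_eq_zero' := Prod.ext (map_one_eq_zero _) (by
    change D k A (d 1) = 0
    simp)
  leibniz' f g := Prod.ext (leibniz _ f g) (by
    change D k A (d (f * g)) = (f • D k A (d g) + d f • D k A g) + (g • D k A (d f) + d g • D k A f)
    simp only [leibniz, smul_eq_mul, map_add]
    abel)

lemma fst_lift_twistedD (d : Derivation k A A) (ω : Ω[A⁄k]) :
    Twist.fst d _ (d.twistedD.liftKaehlerDifferential ω) = ω := by
  have h : ω ∈ Submodule.span A (Set.range (D k A)) := span_range_derivation k A ▸ trivial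
  induction h using Submodule.span_induction with
  | mem x hx =>
    obtain ⟨f, rfl⟩ := hx
    rw [liftKaehlerDifferential_comp_D]
    rfl
  | zero => simp only [map_zero]
  | add x y _ _ hx hy => rw [map_add, map_add, hx, hy]
  | smul a x _ hx => rw [LinearMap.map_smul, Twist.fst_smul, hx]

/-- The Lie derivative of differentials along a derivation. -/
noncomputable def lieDerivative (d : Derivation k A A) : Ω[A⁄k] →+ Ω[A⁄k] :=
  (Twist.snd d _).comp d.twistedD.liftKaehlerDifferential.toAddMonoidHom

lemma lieDerivative_smul (d : Derivation k A A) (a : A) (ω : Ω[A⁄k]) :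
    d.lieDerivative (a • ω) = a • d.lieDerivative ω + d a • ω := by
  change Twist.snd d _ (d.twistedD.liftKaehlerDifferential (a • ω)) = _
  rw [LinearMap.map_smul, Twist.snd_smul, fst_lift_twistedD]
  rfl

/-- The Lie derivative of a linear form on the module of differentials. -/
noncomputable def lieDerivativeDual (d : Derivation k A A) (φ : Module.Dual A Ω[A⁄k]) :
    Module.Dual A Ω[A⁄k] where
  toFun ω := d (φ ω) - φ (d.lieDerivative ω)
  map_add' x y := by simp only [map_add]; abel
  map_smul' a x := by
    simp only [LinearMap.map_smul, lieDerivative_smul, map_add, smul_eq_mul, leibniz,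
      RingHom.id_apply]
    ring

/-- The commutator of L_d with φ ⊗ η is L_d φ ⊗ η + φ ⊗ L_d η, again a sum of rank one maps. -/
lemma exists_dualTensorHom_eq_lieDerivative_sub (d : Derivation k A A)
    (t : Module.Dual A Ω[A⁄k] ⊗[A] Ω[A⁄k]) :
    ∃ s, ∀ ω, dualTensorHom A Ω[A⁄k] Ω[A⁄k] s ω =
      d.lieDerivative (dualTensorHom A _ _ t ω) - dualTensorHom A _ _ t (d.lieDerivative ω) := by
  induction t with
  | zero => exact ⟨0, fun ω => by simp⟩
  | tmul φ η =>
    refine ⟨d.lieDerivativeDual φ ⊗ₜ η + φ ⊗ₜ d.lieDerivative η, fun ω => ?_⟩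
    simp only [map_add, LinearMap.add_apply, dualTensorHom_apply, lieDerivative_smul,
      lieDerivativeDual, LinearMap.coe_mk, AddHom.coe_mk]
    module
  | add x y hx hy =>
    obtain ⟨s, hs⟩ := hx
    obtain ⟨u, hu⟩ := hy
    refine ⟨s + u, fun ω => ?_⟩
    simp only [map_add, LinearMap.add_apply, hs, hu]
    abel

theorem isStable_splittingIdeal_kaehlerDifferential :
    IsStable k (Module.splittingIdeal A Ω[A⁄k]) := by
  intro d c hc
  obtain ⟨t, ht⟩ := Module.mem_splittingIdeal.1 hc
  obtain ⟨s, hs⟩ := exists_dualTensorHom_eq_lieDerivative_sub d t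
  refine Module.mem_splittingIdeal.2 ⟨s, fun ω => ?_⟩
  -- The commutator of L_d with multiplication by c is multiplication by `d c`.
  rw [hs, ht, ht, lieDerivative_smul, add_sub_cancel_left]

end Derivation

/-! ### Euler fields at rational points -/

namespace Derivation

section Point

variable {k A : Type*} [Field k] [CommRing A] [Algebra k A] (φ : A →ₐ[k] k)

lemma sub_algebraMap_mem_ker (f : A) : f - algebraMap k A (φ f) ∈ RingHom.ker φ := by
  simp [RingHom.mem_ker]

/-- The differential at a rational point, with values in the cotangent space. -/
noncomputable def cotangentAt : Derivation k A (RingHom.ker φ).Cotangent :=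
  Derivation.mk'
    { toFun := fun f => (RingHom.ker φ).toCotangent ⟨_, sub_algebraMap_mem_ker φ f⟩
      map_add' := fun f g => by
        rw [← map_add]
        congr 1
        ext
        simp only [map_add, Submodule.coe_add]
        ring
      map_smul' := fun c f => by
        rw [RingHom.id_apply, ← algebraMap_smul A c ((RingHom.ker φ).toCotangent _),
          ← LinearMap.map_smul]
        congr 1
        ext
        simp only [smul_eq_mul, map_mul, Submodule.coe_smul, Algebra.smul_def]
        simp [mul_sub] }
    fun f g => by
      change (RingHom.ker φ).toCotangent _ = f • (RingHom.ker φ).toCotangent _ +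
        g • (RingHom.ker φ).toCotangent _
      rw [← LinearMap.map_smul, ← LinearMap.map_smul, ← map_add, Ideal.toCotangent_eq]
      simp only [map_mul, Submodule.coe_add, Submodule.coe_smul, smul_eq_mul]
      -- The Leibniz rule fails before reduction by exactly `-(f - φ f) * (g - φ g)`.
      have := neg_mem (Ideal.mul_mem_mul (sub_algebraMap_mem_ker φ f) (sub_algebraMap_mem_ker φ g))
      rw [← pow_two] at this
      convert this using 1
      ring

lemma cotangentAt_apply_of_mem {f : A} (hf : f ∈ RingHom.ker φ) :
    cotangentAt φ f = (RingHom.ker φ).toCotangent ⟨f, hf⟩ := by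
  change (RingHom.ker φ).toCotangent _ = _
  congr 1
  ext
  simp [RingHom.mem_ker.1 hf]

end Point

section Euler

variable {k A : Type*} [CommRing k] [CommRing A] [Algebra k A]

lemma apply_mem_mul_of_mem_smul_top {m I J : Ideal A} {E : Derivation k A A}
    (hE : E ∈ m • (⊤ : Submodule A (Derivation k A A)))
    (hI : ∀ d : Derivation k A A, ∀ f ∈ I, d f ∈ J) {f : A} (hf : f ∈ I) : E f ∈ m * J := by
  induction hE using Submodule.smul_induction_on' with
  | smul a ha d _ => exact Ideal.mul_mem_mul ha (hI d f hf)
  | add x _ y _ hx hy => exact add_mem hx hy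

lemma apply_mem_of_mem_smul_top {m : Ideal A} {E : Derivation k A A}
    (hE : E ∈ m • (⊤ : Submodule A (Derivation k A A))) (f : A) : E f ∈ m := by
  simpa using apply_mem_mul_of_mem_smul_top (I := ⊤) (J := ⊤) hE (fun _ _ _ => trivial)
    (f := f) trivial

/-- Eigenvalues add under products by the Leibniz rule: 1 on m / m ^ 2 becomes N on m ^ N / m ^ (N +
1). -/
lemma apply_sub_natCast_mul_mem_pow {m : Ideal A} {E : Derivation k A A} (h0 : ∀ f, E f ∈ m)
    (h1 : ∀ f ∈ m, E f - f ∈ m ^ 2) (N : ℕ) {f : A} (hf : f ∈ m ^ N) :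
    E f - N * f ∈ m ^ (N + 1) := by
  induction N generalizing f with
  | zero => simpa using h0 f
  | succ N ih =>
    rw [pow_succ] at hf
    induction hf using Submodule.mul_induction_on' with
    | mem_mul_mem f hf g hg =>
      have e1 := Ideal.mul_mem_mul hf (h1 g hg)
      have e2 := Ideal.mul_mem_mul (ih hf) hg
      rw [← pow_add] at e1
      rw [← pow_succ] at e2
      convert add_mem e1 e2 using 1
      simp only [leibniz, smul_eq_mul]
      push_cast
      ring
    | add x _ y _ hx hy =>
      convert add_mem hx hy using 1
      rw [map_add]
      ring

end Euler

variable {k A : Type*} [Field k] [CommRing A] [Algebra k A] (φ : A →ₐ[k] k)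

/-- For t = ∑ ψ ⊗ η take E = ∑ a • (ψ ∘ D), where a ∈ m lifts the value of η in m / m ^ 2. -/
lemma exists_toCotangent_apply_eq (t : Module.Dual A Ω[A⁄k] ⊗[A] Ω[A⁄k]) :
    ∃ E ∈ RingHom.ker φ • (⊤ : Submodule A (Derivation k A A)), ∀ f (hf : E f ∈ RingHom.ker φ),
      (RingHom.ker φ).toCotangent ⟨E f, hf⟩ =
        (cotangentAt φ).liftKaehlerDifferential (dualTensorHom A _ _ t (D k A f)) := by
  induction t with
  | zero =>
    refine ⟨0, zero_mem _, fun f hf => ?_⟩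
    rw [map_zero, LinearMap.zero_apply, map_zero, ← map_zero (RingHom.ker φ).toCotangent]
    rfl
  | tmul ψ η =>
    obtain ⟨a, ha⟩ := (RingHom.ker φ).toCotangent_surjective
      ((cotangentAt φ).liftKaehlerDifferential η)
    refine ⟨(a : A) • ψ.compDer (D k A), Submodule.smul_mem_smul a.2 trivial, fun f hf => ?_⟩
    rw [dualTensorHom_apply, LinearMap.map_smul, ← ha]
    refine Eq.trans ?_ (LinearMap.map_smul _ _ _)
    congr 1
    ext
    simp [mul_comm]
  | add x y hx hy =>
    obtain ⟨E, hE, h⟩ := hx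
    obtain ⟨E', hE', h'⟩ := hy
    refine ⟨E + E', add_mem hE hE', fun f hf => ?_⟩
    rw [map_add, LinearMap.add_apply, map_add, ← h f (apply_mem_of_mem_smul_top hE f),
      ← h' f (apply_mem_of_mem_smul_top hE' f), ← map_add]
    rfl

/-- If the module of differentials is finite projective, then there is an Euler vector field at
every rational point. -/
lemma exists_euler (h : Module.splittingIdeal A Ω[A⁄k] = ⊤) :
    ∃ E ∈ RingHom.ker φ • (⊤ : Submodule A (Derivation k A A)),
      ∀ f ∈ RingHom.ker φ, E f - f ∈ RingHom.ker φ ^ 2 := by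
  obtain ⟨t, ht⟩ := Module.mem_splittingIdeal.1 (h ▸ Submodule.mem_top (x := (1 : A)))
  obtain ⟨E, hE, h⟩ := exists_toCotangent_apply_eq φ t
  refine ⟨E, hE, fun f hf => ?_⟩
  have := h f (apply_mem_of_mem_smul_top hE f)
  rwa [ht, one_smul, liftKaehlerDifferential_comp_D, cotangentAt_apply_of_mem φ hf,
    Ideal.toCotangent_eq] at this

theorem eq_bot_of_isStable_of_le_ker [CharZero k] [IsDomain A] [IsNoetherianRing A]
    (h : Module.splittingIdeal A Ω[A⁄k] = ⊤) {I : Ideal A} (hI : IsStable k I)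
    (hle : I ≤ RingHom.ker φ) : I = ⊥ := by
  obtain ⟨E, hE, hE1⟩ := exists_euler φ h
  have hpow : ∀ N, I ≤ RingHom.ker φ ^ (N + 1) := by
    intro N
    induction N with
    | zero => simpa using hle
    | succ N ih =>
      intro f hf
      have h1 := apply_sub_natCast_mul_mem_pow (apply_mem_of_mem_smul_top hE) hE1 _ (ih hf)
      -- Derivations keep f inside I ≤ m ^ (N + 1), and the coefficients of E add a factor m. Since
      -- also E f ≡ (N + 1) f, dividing by N + 1 puts f in m ^ (N + 2).
      have h2 : E f ∈ RingHom.ker φ ^ (N + 1 + 1) := by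
        rw [pow_succ' _ (N + 1)]
        exact apply_mem_mul_of_mem_smul_top hE (fun d f hf => ih (hI d f hf)) hf
      have h3 := Submodule.smul_of_tower_mem _ ((N + 1 : ℕ) : k)⁻¹ (sub_mem h2 h1)
      rwa [sub_sub_cancel, ← nsmul_eq_mul, ← Nat.cast_smul_eq_nsmul k,
        inv_smul_smul₀ (by exact_mod_cast N.succ_ne_zero)] at h3
  rw [eq_bot_iff, ← Ideal.iInf_pow_eq_bot_of_isDomain (RingHom.ker φ) (RingHom.ker_ne_top φ)]
  refine le_iInf fun N => ?_
  exact (hpow N).trans (Ideal.pow_le_pow_right N.le_succ)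

end Derivation

/-- The weak Nullstellensatz. -/
lemma exists_algHom_ker_eq {k A : Type*} [Field k] [IsAlgClosed k] [CommRing A] [Algebra k A]
    [Algebra.FiniteType k A] (m : Ideal A) [m.IsMaximal] :
    ∃ φ : A →ₐ[k] k, RingHom.ker φ = m := by
  let := Ideal.Quotient.field m
  have : Module.Finite k (A ⧸ m) := finite_of_finite_type_of_isJacobsonRing k (A ⧸ m)
  have hb : Function.Bijective (algebraMap k (A ⧸ m)) :=
    IsAlgClosed.algebraMap_bijective_of_isIntegral
  let e := AlgEquiv.ofBijective (Algebra.ofId k (A ⧸ m)) hb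
  refine ⟨(e.symm : (A ⧸ m) →ₐ[k] k).comp (Ideal.Quotient.mkₐ k m), ?_⟩
  ext a
  simp [RingHom.mem_ker, Ideal.Quotient.eq_zero_iff_mem]

theorem Derivation.stableIdealsTrivial_of_splittingIdeal_eq_top {k A : Type*} [Field k]
    [IsAlgClosed k] [CharZero k] [CommRing A] [IsDomain A] [Algebra k A] [Algebra.FiniteType k A]
    (h : Module.splittingIdeal A Ω[A⁄k] = ⊤) : StableIdealsTrivial k A := by
  intro I hI
  have : IsNoetherianRing A := Algebra.FiniteType.isNoetherianRing k A
  refine or_iff_not_imp_right.2 fun hne => ?_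
  obtain ⟨m, hm, hle⟩ := Ideal.exists_le_maximal I hne
  obtain ⟨φ, rfl⟩ := exists_algHom_ker_eq (k := k) m
  exact eq_bot_of_isStable_of_le_ker φ h hI hle

/-! ### Fiber dimensions and local freeness -/

section Rank

variable {R M : Type*} [CommRing R] [AddCommGroup M] [Module R M]

open Module

lemma TensorProduct.span_range_mk_one (S : Type*) [CommRing S] [Algebra R S] :
    Submodule.span S (Set.range (TensorProduct.mk R S M 1)) = ⊤ := by
  rw [← LinearMap.coe_range, LinearMap.range_eq_map, ← Submodule.baseChange_eq_span,
    Submodule.baseChange_top]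

lemma Ideal.finrank_fiber_eq_of_ker_eq (p : Ideal R) [p.IsPrime] (κ : Type*) [Field κ]
    [Algebra R κ] (hp : RingHom.ker (algebraMap R κ) = p) :
    finrank p.ResidueField (p.Fiber M) = finrank κ (κ ⊗[R] M) := by
  let f : p.ResidueField →+* κ := Ideal.ResidueField.lift p (algebraMap R κ) hp.ge
    fun x hx => isUnit_iff_ne_zero.2 fun h => hx (hp ▸ h)
  let := f.toAlgebra
  have : IsScalarTower R p.ResidueField κ := .of_algebraMap_eq fun x =>
    (Ideal.ResidueField.lift_algebraMap ..).symm
  let e : κ ⊗[p.ResidueField] (p.ResidueField ⊗[R] M) ≃ₗ[κ] κ ⊗[R] M :=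
    AlgebraTensorModule.cancelBaseChange _ _ _ _ _
  rw [← e.finrank_eq]
  exact finrank_baseChange.symm

/-- If the classes of the `ω i` span the fiber at a prime, they span the module
up to multiplication by a scalar outside the prime. -/
lemma Ideal.exists_smul_mem_span_of_span_fiber [Module.Finite R M] (p : Ideal R) [p.IsPrime]
    {ι : Type*} (ω : ι → M)
    (h : Submodule.span p.ResidueField
      (Set.range fun i => (1 : p.ResidueField) ⊗ₜ[R] ω i) = ⊤) :
    ∃ s ∉ p, ∀ x : M, s • x ∈ Submodule.span R (Set.range ω) := by
  set N := Submodule.span R (Set.range ω) with hN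
  have hsub : Subsingleton (p.ResidueField ⊗[R] (M ⧸ N)) := by
    let q := N.mkQ.baseChange p.ResidueField
    have hq : Function.Surjective q := LinearMap.lTensor_surjective _ N.mkQ_surjective
    have hq0 : q = 0 := LinearMap.ext_on_range h fun i => by
      simp only [q, LinearMap.baseChange_tmul, Submodule.mkQ_apply, LinearMap.zero_apply]
      rw [(Submodule.Quotient.mk_eq_zero N).2 (Submodule.subset_span ⟨i, rfl⟩), tmul_zero]
    exact subsingleton_of_forall_eq 0 fun y => by
      obtain ⟨x, rfl⟩ := hq y
      rw [hq0, LinearMap.zero_apply]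
  -- The finite module M / N has zero fiber at p, so p is outside its support.
  have hann : ¬ annihilator R (M ⧸ N) ≤ p := fun hle =>
    not_nontrivial_iff_subsingleton.2 hsub
      ((mem_support_iff_nontrivial_residueField_tensorProduct ⟨p, ‹_›⟩).1
        (mem_support_iff_of_finite.2 hle))
  obtain ⟨s, hs, hsp⟩ := SetLike.not_le_iff_exists.1 hann
  refine ⟨s, hsp, fun x => ?_⟩
  have := mem_annihilator.1 hs (Submodule.Quotient.mk x)
  rwa [← Submodule.Quotient.mk_smul, Submodule.Quotient.mk_eq_zero] at this

/-- Over the fraction field s is invertible, so the ω i span a space whose dimension is their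
number. -/
lemma linearIndependent_of_smul_mem_span [IsDomain R] {ι : Type*} [Fintype ι] (ω : ι → M)
    (hcard : Fintype.card ι = finrank R M) {s : R} (hs : s ≠ 0)
    (h : ∀ x : M, s • x ∈ Submodule.span R (Set.range ω)) : LinearIndependent R ω := by
  let K := FractionRing R
  let j : M →ₗ[R] K ⊗[R] M := TensorProduct.mk R K M 1
  have hj : IsBaseChange K j := TensorProduct.isBaseChange R M K
  have hsK : algebraMap R K s ≠ 0 := by simpa using hs
  have hspan : ⊤ ≤ Submodule.span K (Set.range (j ∘ ω)) := by
    rw [← TensorProduct.span_range_mk_one, Submodule.span_le]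
    rintro _ ⟨x, rfl⟩
    have hx : j (s • x) ∈ Submodule.span K (Set.range (j ∘ ω)) := by
      refine Submodule.span_le_restrictScalars R K _ ?_
      rw [Set.range_comp, Submodule.span_image]
      exact Submodule.mem_map_of_mem (h x)
    have := Submodule.smul_mem _ (algebraMap R K s)⁻¹ hx
    rwa [map_smul, ← algebraMap_smul K s, inv_smul_smul₀ hsK] at this
  have hli := linearIndependent_of_top_le_span_of_card_eq_finrank hspan
    (hcard.trans hj.finrank_eq.symm)
  exact .of_comp j (hli.restrict_scalars' R)

/-- Multiplication by s factors through the free module on the ω i. -/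
lemma smul_mem_splittingIdeal {ι : Type*} [Fintype ι] (ω : ι → M) (hω : LinearIndependent R ω)
    {s : R} (h : ∀ x : M, s • x ∈ Submodule.span R (Set.range ω)) :
    s ∈ splittingIdeal R M := by
  let b := Basis.span hω
  let f : M →ₗ[R] Submodule.span R (Set.range ω) := (LinearMap.lsmul R M s).codRestrict _ h
  refine mem_splittingIdeal.2 ⟨∑ i, (b.coord i ∘ₗ f) ⊗ₜ ω i, fun x => ?_⟩
  have hf : (f x : M) = s • x := rfl
  have := congr_arg Subtype.val (b.sum_repr (f x))
  rw [AddSubmonoidClass.coe_finsetSum, hf] at this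
  simpa [b, Basis.span_apply] using this

/-- Where the fiber has the dimension of the generic fiber, the module is locally free. -/
theorem exists_mem_splittingIdeal_notMem [IsDomain R] [Module.Finite R M] (p : Ideal R) [p.IsPrime]
    (h : finrank p.ResidueField (p.Fiber M) = finrank R M) :
    ∃ s ∈ splittingIdeal R M, s ∉ p := by
  let S : Set (p.ResidueField ⊗[R] M) := Set.range (TensorProduct.mk R p.ResidueField M 1)
  have hS : Submodule.span p.ResidueField S = ⊤ :=
    TensorProduct.span_range_mk_one _
  obtain ⟨v, hv, hvs, -⟩ := Submodule.exists_fun_fin_finrank_span_eq p.ResidueField S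
  choose ω hω using hv
  obtain rfl : (fun i => (1 : p.ResidueField) ⊗ₜ[R] ω i) = v := funext hω
  obtain ⟨s, hsp, hs⟩ := p.exists_smul_mem_span_of_span_fiber ω (hvs.trans hS)
  refine ⟨s, smul_mem_splittingIdeal ω (linearIndependent_of_smul_mem_span ω ?_ ?_ hs) hs, hsp⟩
  · rw [Fintype.card_fin, hS, finrank_top]
    exact h
  · rintro rfl
    exact hsp p.zero_mem

theorem splittingIdeal_ne_bot [IsDomain R] [Module.Finite R M] : splittingIdeal R M ≠ ⊥ := by
  have h : finrank (⊥ : Ideal R).ResidueField ((⊥ : Ideal R).Fiber M) = finrank R M := by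
    have : FaithfulSMul R (⊥ : Ideal R).ResidueField := by
      rw [faithfulSMul_iff_algebraMap_injective, RingHom.injective_iff_ker_eq_bot]
      exact Ideal.ker_algebraMap_residueField ⊥
    exact (TensorProduct.isBaseChange R M (⊥ : Ideal R).ResidueField).finrank_eq
  obtain ⟨s, hs, hs0⟩ := exists_mem_splittingIdeal_notMem ⊥ h
  exact (Submodule.ne_bot_iff _).2 ⟨s, hs, hs0⟩

/-- M is finite projective, and over a domain its rank is constant. -/
theorem finrank_baseChange_eq_of_splittingIdeal_eq_top [IsDomain R]
    (h : splittingIdeal R M = ⊤) (κ : Type*) [Field κ] [Algebra R κ] :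
    finrank κ (κ ⊗[R] M) = finrank R M := by
  rw [← one_mem_range_dualTensorHom_iff] at h
  have := Module.Finite.of_one_mem_range_dualTensorHom h
  have := Projective.of_one_mem_range_dualTensorHom h
  have : (RingHom.ker (algebraMap R κ)).IsPrime := RingHom.ker_isPrime _
  rw [← Ideal.finrank_fiber_eq_of_ker_eq _ κ rfl, Ideal.finrank_fiber_eq_finrank]

end Rank

/-! ### Differentials and transcendence degree -/

section Transcendence

variable (k : Type*) {K : Type*} [Field k] [Field K] [CharZero k] [Algebra k K]

/-- K is a separable algebraic extension, by characteristic 0, of a localization of the polynomial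
ring. -/
lemma IsTranscendenceBasis.formallyEtale {ι : Type*} {x : ι → K} (hx : IsTranscendenceBasis k x) :
    letI := (MvPolynomial.aeval (R := k) x).toAlgebra
    Algebra.FormallyEtale (MvPolynomial ι k) K := by
  let := (MvPolynomial.aeval (R := k) x).toAlgebra
  have : FaithfulSMul (MvPolynomial ι k) K :=
    (faithfulSMul_iff_algebraMap_injective _ _).2 hx.1
  let F := FractionRing (MvPolynomial ι k)
  let : Algebra F K := FractionRing.liftAlgebra _ _
  have hk : IsScalarTower k (MvPolynomial ι k) K := .of_algebraMap_eq' (by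
    rw [RingHom.algebraMap_toAlgebra]
    exact ((MvPolynomial.aeval (R := k) x).comp_algebraMap).symm)
  have : Algebra.IsAlgebraic (MvPolynomial ι k) K :=
    hx.isAlgebraic_iff.2 fun i => by
      have : x i = algebraMap (MvPolynomial ι k) K (MvPolynomial.X i) := by
        simp [RingHom.algebraMap_toAlgebra]
      exact this ▸ isAlgebraic_algebraMap _
  have : Algebra.IsAlgebraic F K :=
    .extendScalars (R := MvPolynomial ι k) (IsFractionRing.injective _ F)
  have : CharZero F := charZero_of_injective_algebraMap (algebraMap k F).injective
  have : Algebra.FormallyEtale F K := .of_isSeparable F K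
  have : Algebra.FormallyEtale (MvPolynomial ι k) F :=
    .of_isLocalization (nonZeroDivisors (MvPolynomial ι k))
  exact .comp _ F K

theorem KaehlerDifferential.rank_eq_trdeg : Module.rank K Ω[K⁄k] = Algebra.trdeg k K := by
  obtain ⟨ι, x, hx⟩ := exists_isTranscendenceBasis' k K
  let := (MvPolynomial.aeval (R := k) x).toAlgebra
  have : Algebra.FormallyEtale (MvPolynomial ι k) K := hx.formallyEtale
  have hk : IsScalarTower k (MvPolynomial ι k) K := .of_algebraMap_eq' (by
    rw [RingHom.algebraMap_toAlgebra]
    exact ((MvPolynomial.aeval (R := k) x).comp_algebraMap).symm)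
  let b := ((mvPolynomialBasis k ι).baseChange K).map
    (tensorKaehlerEquivOfFormallyEtale k (MvPolynomial ι k) K)
  rw [← hx.cardinalMk_eq_trdeg, ← b.mk_eq_rank'']

end Transcendence

/-! ### Algebras of finite type over a field -/

section FiniteType

variable (k A : Type*) [Field k] [CommRing A] [IsDomain A] [Algebra k A]

theorem KaehlerDifferential.rank_eq_trdeg_fractionRing [CharZero k] :
    Module.rank A Ω[A⁄k] = Algebra.trdeg k (FractionRing A) := by
  have : Algebra.FormallyEtale A (FractionRing A) := .of_isLocalization (nonZeroDivisors A)
  rw [← rank_eq_trdeg, (isBaseChange_of_formallyEtale k A (FractionRing A)).rank_eq]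

variable [Algebra.FiniteType k A]

instance Derivation.finite : Module.Finite A (Derivation k A A) :=
  have := Algebra.FiniteType.isNoetherianRing k A
  .equiv (linearMapEquivDerivation k A (M := A))

variable {k A}

theorem Derivation.splittingIdeal_eq_top_of_isSimple
    (h : LieAlgebra.IsSimple k (Derivation k A A)) : Module.splittingIdeal A Ω[A⁄k] = ⊤ :=
  (stableIdealsTrivial_of_isSimple h _ isStable_splittingIdeal_kaehlerDifferential).resolve_left
    splittingIdeal_ne_bot

theorem Derivation.isSimple_of_splittingIdeal_eq_top [IsAlgClosed k] [CharZero k]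
    (h : Module.splittingIdeal A Ω[A⁄k] = ⊤) (hA : ¬ Function.Surjective (algebraMap k A)) :
    LieAlgebra.IsSimple k (Derivation k A A) := by
  have : CharZero A := charZero_of_injective_algebraMap (algebraMap k A).injective
  -- Without derivations the dual of Ω vanishes, hence so does the identity of Ω. Then the
  -- transcendence degree is 0 and A = k.
  have : Nontrivial (Derivation k A A) := by
    by_contra hn
    rw [not_nontrivial_iff_subsingleton] at hn
    have hdual : Subsingleton (Module.Dual A Ω[A⁄k]) :=
      (linearMapEquivDerivation k A (M := A)).toEquiv.subsingleton
    have hzero (t : Module.Dual A Ω[A⁄k] ⊗[A] Ω[A⁄k]) : dualTensorHom A Ω[A⁄k] Ω[A⁄k] t = 0 := by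
      induction t with
      | zero => exact map_zero _
      | tmul ψ η => rw [Subsingleton.elim ψ 0, zero_tmul, map_zero]
      | add x y hx hy => rw [map_add, hx, hy, add_zero]
    obtain ⟨t, ht⟩ := Module.mem_splittingIdeal.1 (h ▸ Submodule.mem_top (x := (1 : A)))
    have hΩ : Subsingleton Ω[A⁄k] := subsingleton_of_forall_eq 0 fun x => by
      rw [← one_smul A x, ← ht, hzero, LinearMap.zero_apply]
    have hrank : Algebra.trdeg k (FractionRing A) = 0 := by
      rw [← rank_eq_trdeg_fractionRing, rank_subsingleton']
    have := trdeg_eq_zero_iff.1 hrank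
    have : Algebra.IsAlgebraic k A :=
      .of_injective (IsScalarTower.toAlgHom k A (FractionRing A)) (IsFractionRing.injective _ _)
    exact hA IsAlgClosed.algebraMap_bijective_of_isIntegral.2
  exact isSimple_of_stableIdealsTrivial two_ne_zero
    (stableIdealsTrivial_of_splittingIdeal_eq_top h)

theorem splittingIdeal_eq_top_iff_forall_finrank_eq [IsAlgClosed k] :
    Module.splittingIdeal A Ω[A⁄k] = ⊤ ↔ ∀ φ : A →ₐ[k] k, letI := φ.toAlgebra
      Module.finrank k (k ⊗[A] Ω[A⁄k]) = Module.finrank A Ω[A⁄k] := by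
  constructor
  · intro h φ
    exact @finrank_baseChange_eq_of_splittingIdeal_eq_top _ _ _ _ _ _ h k _ φ.toAlgebra
  · intro h
    by_contra hne
    obtain ⟨m, hm, hle⟩ := Ideal.exists_le_maximal _ hne
    obtain ⟨φ, hφ⟩ := exists_algHom_ker_eq (k := k) m
    obtain ⟨s, hs, hsm⟩ := exists_mem_splittingIdeal_notMem m
      ((@Ideal.finrank_fiber_eq_of_ker_eq _ _ _ _ _ m _ k _ φ.toAlgebra hφ).trans (h φ))
    exact hsm (hle hs)

end FiniteType

lemma Derivation.finrank_eq_finrank_baseChange (k A : Type*) [Field k] [CommRing A] [Algebra k A]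
    [Algebra A k] [IsScalarTower k A k] :
    Module.finrank k (Derivation k A k) = Module.finrank k (k ⊗[A] Ω[A⁄k]) := by
  let e : (Ω[A⁄k] →ₗ[A] k) ≃ₗ[k] Derivation k A k :=
    (linearMapEquivDerivation k A (M := k)).restrictScalars k
  rw [← e.finrank_eq, (LinearMap.liftBaseChangeEquiv (R := A) (M := Ω[A⁄k]) (N := k) k).finrank_eq]
  exact Subspace.dual_finrank_eq

/-! ### Points and tangent spaces of affine varieties -/

namespace AffineVariety

variable {k : Type*} [Field k] {n : ℕ} {X : Set (Fin n → k)}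

lemma IsIrreducibleVariety.isPrime_vanishingIdeal (hX : IsIrreducibleVariety X) :
    (vanishingIdeal k X).IsPrime := by
  refine Ideal.isPrime_iff.2 ⟨?_, fun {f g} hfg => ?_⟩
  · obtain ⟨P, hP⟩ := hX.nonempty
    rw [Ideal.ne_top_iff_one]
    exact fun h => one_ne_zero ((map_one _).symm.trans (mem_vanishingIdeal_iff.1 h P hP))
  · have hV (f : MvPolynomial (Fin n) k) : IsAlgebraicSet {x | eval x f = 0} := ⟨{f}, by simp⟩
    refine (hX.irreducible _ _ (hV f) (hV g) fun P hP => ?_).imp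
      (fun h => mem_vanishingIdeal_iff.2 fun P hP => ?_)
      (fun h => mem_vanishingIdeal_iff.2 fun P hP => ?_)
    · have := mem_vanishingIdeal_iff.1 hfg P hP
      rw [aeval_eq_eval, map_mul] at this
      exact mul_eq_zero.1 this
    · exact h hP
    · exact h hP

/-- Evaluation at a point of `X` of the polynomial functions on `X`. -/
noncomputable def evalAt {P : Fin n → k} (hP : P ∈ X) : CoordinateRing X →ₐ[k] k :=
  Ideal.Quotient.liftₐ _ (aeval P) fun _ hf => mem_vanishingIdeal_iff.1 hf P hP

lemma evalAt_mk {P : Fin n → k} (hP : P ∈ X) (f : MvPolynomial (Fin n) k) :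
    evalAt hP (Ideal.Quotient.mk _ f) = eval P f := by
  rw [← aeval_eq_eval]
  exact Ideal.Quotient.liftₐ_apply ..

/-- Every rational point of the coordinate ring is the evaluation at a point of `X`. -/
lemma IsAlgebraicSet.exists_eq_evalAt (hX : IsAlgebraicSet X) (φ : CoordinateRing X →ₐ[k] k) :
    ∃ P, ∃ hP : P ∈ X, φ = evalAt hP := by
  let P : Fin n → k := fun i => φ (Ideal.Quotient.mk _ (.X i))
  have hφ (f : MvPolynomial (Fin n) k) : φ (Ideal.Quotient.mk _ f) = eval P f := by
    have : φ.comp (Ideal.Quotient.mkₐ k _) = aeval P := by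
      ext i
      simp [P]
    rw [← aeval_eq_eval, ← this]
    rfl
  have hP : P ∈ X := by
    obtain ⟨S, rfl⟩ := hX
    intro f hf
    have hfI : f ∈ vanishingIdeal k {x | ∀ f ∈ S, eval x f = 0} :=
      mem_vanishingIdeal_iff.2 fun x hx => hx f hf
    rw [← hφ, Ideal.Quotient.eq_zero_iff_mem.2 hfI, map_zero]
  refine ⟨P, hP, Ideal.Quotient.algHom_ext _ ?_⟩
  ext i
  simp [P, evalAt]

lemma not_surjective_algebraMap_coordinateRing (hX : X.Nontrivial) :
    ¬ Function.Surjective (algebraMap k (CoordinateRing X)) := by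
  intro h
  obtain ⟨P, hP, Q, hQ, hne⟩ := hX
  refine hne (funext fun i => ?_)
  obtain ⟨c, hc⟩ := h (Ideal.Quotient.mk _ (.X i))
  have h1 := congr_arg (evalAt hP) hc
  have h2 := congr_arg (evalAt hQ) hc
  rw [AlgHom.commutes, evalAt_mk, eval_X] at h1 h2
  exact h1.symm.trans h2

section TangentSpace

variable [Algebra (CoordinateRing X) k] [IsScalarTower k (CoordinateRing X) k] {P : Fin n → k}
  (hP : ∀ f, algebraMap (CoordinateRing X) k (Ideal.Quotient.mk _ f) = eval P f)

include hP

omit [IsScalarTower k (CoordinateRing X) k] in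
lemma derivation_mk_eq_sum (d : Derivation k (CoordinateRing X) k) (f : MvPolynomial (Fin n) k) :
    d (Ideal.Quotient.mk _ f) =
      ∑ j, eval P (pderiv j f) * d (Ideal.Quotient.mk _ (.X j)) := by
  induction f using MvPolynomial.induction_on with
  | C a =>
    simp only [pderiv_C, map_zero, zero_mul, Finset.sum_const_zero]
    exact d.map_algebraMap a
  | add f g hf hg => simp only [map_add, add_mul, Finset.sum_add_distrib, hf, hg]
  | mul_X f i hf =>
    simp only [map_mul, Derivation.leibniz, Algebra.smul_def, hP, eval_X, hf, pderiv_X, map_add,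
      add_mul, Finset.sum_add_distrib, Finset.mul_sum, Pi.single_apply, apply_ite, map_zero,
      ite_mul, mul_one, mul_zero, zero_mul]
    simp [mul_assoc]

theorem finrank_tangentSpace :
    Module.finrank k (tangentSpace X P) = Module.finrank k (Derivation k (CoordinateRing X) k) := by
  let T : Derivation k (CoordinateRing X) k →ₗ[k] (Fin n → k) :=
    { toFun := fun d j => d (Ideal.Quotient.mk _ (.X j))
      map_add' := fun _ _ => rfl
      map_smul' := fun _ _ => rfl }
  have hT : Function.Injective T := fun d e h => Derivation.ext fun a => by
    obtain ⟨f, rfl⟩ := Ideal.Quotient.mk_surjective a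
    rw [derivation_mk_eq_sum hP, derivation_mk_eq_sum hP]
    exact Finset.sum_congr rfl fun j _ => congr_arg _ (congr_fun h j)
  -- A tangent vector v gives the derivation f ↦ ∑ (∂f/∂x_j)(P) v_j, which descends to k[X] exactly
  -- by tangency.
  have hrange : LinearMap.range T = tangentSpace X P := by
    ext v
    constructor
    · rintro ⟨d, rfl⟩ f hf
      rw [← map_zero d, ← Ideal.Quotient.eq_zero_iff_mem.2 hf, derivation_mk_eq_sum hP]
      rfl
    · intro hv
      let δ₀ : MvPolynomial (Fin n) k →ₗ[k] k :=
        ∑ j, v j • ((aeval P).toLinearMap ∘ₗ (pderiv j).toLinearMap)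
      have hδ₀ (f) : δ₀ f = ∑ j, eval P (pderiv j f) * v j := by
        simp [δ₀, LinearMap.sum_apply, aeval_eq_eval, mul_comm]
      let δ : CoordinateRing X →ₗ[k] k :=
        (((vanishingIdeal k X).restrictScalars k).liftQ δ₀ fun f hf => (hδ₀ f).trans (hv f hf)) ∘ₗ
          (Submodule.Quotient.restrictScalarsEquiv k (vanishingIdeal k X)).symm.toLinearMap
      have hδ (f) : δ (Ideal.Quotient.mk _ f) = ∑ j, eval P (pderiv j f) * v j := hδ₀ f
      refine ⟨Derivation.mk' δ fun a b => ?_, funext fun i => ?_⟩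
      · obtain ⟨f, rfl⟩ := Ideal.Quotient.mk_surjective a
        obtain ⟨g, rfl⟩ := Ideal.Quotient.mk_surjective b
        rw [← map_mul, hδ, hδ, hδ, Algebra.smul_def, Algebra.smul_def, hP, hP, Finset.mul_sum,
          Finset.mul_sum, ← Finset.sum_add_distrib]
        refine Finset.sum_congr rfl fun j _ => ?_
        simp only [Derivation.leibniz, smul_eq_mul, map_add, map_mul]
        ring
      · change δ (Ideal.Quotient.mk _ (.X i)) = v i
        rw [hδ]
        simp [pderiv_X, Pi.single_apply, apply_ite]
  rw [← hrange, (LinearEquiv.ofInjective T hT).finrank_eq]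

end TangentSpace

theorem IsIrreducibleVariety.isNonsingularAt_iff [CharZero k] (hX : IsIrreducibleVariety X)
    {P : Fin n → k} (hP : P ∈ X) :
    IsNonsingularAt X P ↔ letI := (evalAt hP).toAlgebra
      Module.finrank k (k ⊗[CoordinateRing X] Ω[CoordinateRing X⁄k]) =
        Module.finrank (CoordinateRing X) Ω[CoordinateRing X⁄k] := by
  have := hX.isPrime_vanishingIdeal
  let := (evalAt hP).toAlgebra
  have : IsScalarTower k (CoordinateRing X) k := .of_algebraMap_eq' (evalAt hP).comp_algebraMap.symm
  rw [← Derivation.finrank_eq_finrank_baseChange, ← finrank_tangentSpace (evalAt_mk hP),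
    IsNonsingularAt, dim, ← rank_eq_trdeg_fractionRing, ← Module.finrank_eq_rank,
    ← Module.finrank_eq_rank, Nat.cast_inj]

theorem IsIrreducibleVariety.isSmoothVariety_iff [IsAlgClosed k] [CharZero k]
    (hX : IsIrreducibleVariety X) :
    IsSmoothVariety X ↔
      Module.splittingIdeal (CoordinateRing X) Ω[CoordinateRing X⁄k] = ⊤ := by
  have := hX.isPrime_vanishingIdeal
  rw [splittingIdeal_eq_top_iff_forall_finrank_eq (k := k)]
  constructor
  · intro h φ
    obtain ⟨P, hP, rfl⟩ := hX.isAlgebraicSet.exists_eq_evalAt φ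
    exact (hX.isNonsingularAt_iff hP).1 (h P hP)
  · exact fun h P hP => (hX.isNonsingularAt_iff hP).2 (h _)

end AffineVariety

theorem theorem1p1 {k : Type*} [Field k] [IsAlgClosed k] [CharZero k] (n : ℕ)
    (X : Set (Fin n → k)) (hX : AffineVariety.IsIrreducibleVariety X) (hpt : X.Nontrivial) :
    LieAlgebra.IsSimple k (AffineVariety.VectorFields X) ↔ AffineVariety.IsSmoothVariety X := by
  have := hX.isPrime_vanishingIdeal
  rw [hX.isSmoothVariety_iff]
  exact ⟨Derivation.splittingIdeal_eq_top_of_isSimple, fun h =>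
    Derivation.isSimple_of_splittingIdeal_eq_top h
      (AffineVariety.not_surjective_algebraMap_coordinateRing hpt)⟩
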